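/- Let $A\in\mathbb{R}^{n_x\times n_x}$, $B\in\mathbb{R}^{n_x\times n_a}$, $C_p\in\mathbb{R}^{n_p\times n_x}$, $D_p\in\mathbb{R}^{n_p\times n_a}$, $C_r\in\mathbb{R}^{n_r\times n_x}$, $D_r\in\mathbb{R}^{n_r\times n_a}$ be the closed-loop matrices, for one uncertainty realization $\delta_i$, of the system $$x[k+1]=Ax[k]+Ba[k],\qquad y_p[k]=C_px[k]+D_pa[k],\qquad y_r[k]=C_rx[k]+D_ra[k],$$ and assume that the system is stable, i.e. all eigenvalues of $A$ lie in the open unit disk. Let $\tilde\Sigma_{p,i}=(A,B,C_p,D_p)$ be the performance system and $\tilde\Sigma_{r,i}=(A,B,C_r,D_r)$ the detector-output system, with transfer matrices $G_\bullet(z)=C_\bullet(zI-A)^{-1}B+D_\bullet$ for $\bullet\in\{p,r\}$. A complex number $z_0$ is called a zero of $\tilde\Sigma_\bullet$ if $G_\bullet(z_0)s=0$ for some $s\in\mathbb{C}^{n_a}$, $s\neq0$. For $k\geq1$ and a polynomial vector $s(z)\in\mathbb{C}[z]^{n_a}$ with $s(z_0)\neq0$, $z_0$ is called a zero of $\tilde\Sigma_\bullet$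 of multiplicity at least $k$ with (generalized) input direction $s(\cdot)$ if $G_\bullet(z)s(z)=O((z-z_0)^k)$ as $z\to z_0$. Then the optimal value of the semidefinite program $$\inf\Big\{\gamma\;\Big|\;\gamma\ge0,\ P=P^T\in\mathbb{R}^{n_x\times n_x},\ \begin{bmatrix}A^TPA-P&A^TPB\\B^TPA&B^TPB\end{bmatrix}+\begin{bmatrix}C_p^T\\D_p^T\end{bmatrix}\begin{bmatrix}C_p&D_p\end{bmatrix}-\gamma\begin{bmatrix}C_r^T\\D_r^T\end{bmatrix}\begin{bmatrix}C_r&D_r\end{bmatrix}\preceq0\Big\}$$ (with value $+\infty$ if it is infeasible) is finite if and only if at least one of the following conditions holds: 1. $\tilde\Sigma_{r,i}$ has no zeros on the unit circle; 2. every zero of $\tilde\Sigma_{r,i}$ on the unit circle is also a zero of $\tilde\Sigma_{p,i}$, including multiplicity and input direction: whenever $|z_0|=1$ and $z_0$ is a zero of $\tilde\Sigma_{r,i}$ of multiplicity at least $k$ with input direction $s(\cdot)$, it is a zero of $\tilde\Sigma_{p,i}$ of multiplicity at least $k$ with the same input direction $s(\cdot)$. -/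

import Mathlib

open scoped Matrix Topology

/-- A real discrete-time linear system `x⁺ = A x + B a`, `y = C x + D a`, with state, input
and output coordinates indexed by `n`, `m`, `p`. -/
structure StateSpace (n m p : Type*) where
  A : Matrix n n ℝ
  B : Matrix n m ℝ
  C : Matrix p n ℝ
  D : Matrix p m ℝ

namespace StateSpace

variable {n m p : Type*} [Fintype n] [DecidableEq n]

/-- The transfer matrix `G(z) = C (z I - A)⁻¹ B + D` (meaningful where `z I - A` is invertible). -/
noncomputable def transfer (S : StateSpace n m p) (z : ℂ) : Matrix p m ℂ :=
  S.C.map Complex.ofReal *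
      (z • (1 : Matrix n n ℂ) - S.A.map Complex.ofReal)⁻¹ * S.B.map Complex.ofReal +
    S.D.map Complex.ofReal

variable [Fintype m]

/-- `z₀` is a zero of the system: some nonzero input direction is blocked, `G(z₀) s = 0`. -/
def IsZero (S : StateSpace n m p) (z₀ : ℂ) : Prop :=
  ∃ s : m → ℂ, s ≠ 0 ∧ S.transfer z₀ *ᵥ s = 0

/-- `z₀` is a zero of multiplicity at least `k` along the (generalized) input direction `s`,
that is, `s` is a root polynomial of `G` at `z₀`: a polynomial vector with `s(z₀) ≠ 0` for which
`G(z) s(z)` vanishes at `z₀` to order at least `k`. The Taylor coefficients of `s` at `z₀` are the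
input zero direction `s(z₀)` followed by the generalized input directions of the chain. -/
def IsZeroAlong [Fintype p] (S : StateSpace n m p) (z₀ : ℂ) (k : ℕ)
    (s : m → Polynomial ℂ) : Prop :=
  1 ≤ k ∧ (fun j => (s j).eval z₀) ≠ 0 ∧
    (fun z : ℂ => S.transfer z *ᵥ fun j => (s j).eval z) =O[𝓝 z₀] fun z => (z - z₀) ^ k

end StateSpace

/-- One realization of the closed-loop system under attack: `x⁺ = A x + B a` with performance
output `y_p = C_p x + D_p a` and detector output `y_r = C_r x + D_r a`. -/
structure ClosedLoop (n m p r : Type*) where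
  A : Matrix n n ℝ
  B : Matrix n m ℝ
  Cp : Matrix p n ℝ
  Dp : Matrix p m ℝ
  Cr : Matrix r n ℝ
  Dr : Matrix r m ℝ

namespace ClosedLoop

variable {n m p r : Type*}

/-- The performance system, with output `y_p`. -/
def perf (S : ClosedLoop n m p r) : StateSpace n m p := ⟨S.A, S.B, S.Cp, S.Dp⟩

/-- The detector-output system, with output `y_r`. -/
def detector (S : ClosedLoop n m p r) : StateSpace n m r := ⟨S.A, S.B, S.Cr, S.Dr⟩

variable [Fintype n]

/-- Stability in discrete time: every complex eigenvalue of `A` lies in the open unit disk. -/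
def IsStable [DecidableEq n] (S : ClosedLoop n m p r) : Prop :=
  ∀ z ∈ spectrum ℂ (S.A.map Complex.ofReal), ‖z‖ < 1

variable [Fintype m] [Fintype p] [Fintype r]

/-- The matrix `M(γ, P)` of the linear matrix inequality `M(γ, P) ⪯ 0`. -/
def lmiMatrix (S : ClosedLoop n m p r) (γ : ℝ) (P : Matrix n n ℝ) :
    Matrix (n ⊕ m) (n ⊕ m) ℝ :=
  Matrix.fromBlocks
      (S.Aᵀ * P * S.A - P) (S.Aᵀ * P * S.B)
      (S.Bᵀ * P * S.A) (S.Bᵀ * P * S.B) +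
    (Matrix.fromCols S.Cp S.Dp)ᵀ * Matrix.fromCols S.Cp S.Dp -
    γ • ((Matrix.fromCols S.Cr S.Dr)ᵀ * Matrix.fromCols S.Cr S.Dr)

/-- The feasible pairs `(γ, P)` of the semidefinite program. -/
def Feasible (S : ClosedLoop n m p r) (γ : ℝ) (P : Matrix n n ℝ) : Prop :=
  0 ≤ γ ∧ P.IsSymm ∧ (-(S.lmiMatrix γ P)).PosSemidef

/-- The optimal value `inf {γ | γ ≥ 0, P = Pᵀ, M(γ, P) ⪯ 0}` of the semidefinite program, in the
extended reals; it is `⊤` if the program is infeasible. -/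
noncomputable def sdpValue (S : ClosedLoop n m p r) : EReal :=
  sInf {v : EReal | ∃ (γ : ℝ) (P : Matrix n n ℝ), S.Feasible γ P ∧ v = (γ : EReal)}

end ClosedLoop

/-! Since `γ ≥ 0`, the value is finite exactly when the program is feasible, and feasibility is a
dissipation inequality with storage `xᵀ P x`. Condition 1 makes condition 2 vacuous, so it suffices
to treat condition 2.

Necessity: for exponentials `zᵏ` with `|z| = 1` the storage terms cancel, leaving `|G_p s|² ≤ γ |G_r
s|²` on the circle. Both sides are analytic near `z₀`, and the vanishing order of an analytic
function can be read off along the circle (`Feasible.isZeroAlong`).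

Sufficiency: let `E (x, a) = x` and `Φ (x, a) = A x + B a`, and consider the pencil `z E - Φ` on the
kernel of the detector output. If it has no unimodular eigenvector there, a separation argument
gives a strict inequality (`exists_coercive_storage`) that dominates `|y_p|²` after scaling.
Otherwise an eigenvector is split off and the dimension drops; this works as long as the performance
output vanishes on all unimodular Jordan chains (`exists_storage_of_chainSpace_le_ker`). Chains give
root polynomials of `G_r`, and condition 2 turns these into that vanishing
(`perfOutput_eq_zero_of_mem_chainSpace`). -/

/-! ### Unimodular eigenvectors from a dual certificate -/

section Pencil

open scoped InnerProductSpace InnerProduct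
open InnerProductSpace ContinuousLinearMap

variable {W X Y : Type*}
  [NormedAddCommGroup W] [InnerProductSpace ℂ W] [FiniteDimensional ℂ W]
  [NormedAddCommGroup X] [InnerProductSpace ℂ X] [FiniteDimensional ℂ X]
  [NormedAddCommGroup Y] [InnerProductSpace ℂ Y] [FiniteDimensional ℂ Y]

/-- The eigenvectors of a linear isometry of a finite-dimensional space span it. -/
theorem LinearIsometry.span_eigenvectors_eq_top (V : W →ₗᵢ[ℂ] W) :
    Submodule.span ℂ {v | ∃ z : ℂ, ‖z‖ = 1 ∧ V v = z • v} = ⊤ := by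
  set K := Submodule.span ℂ {v | ∃ z : ℂ, ‖z‖ = 1 ∧ V v = z • v} with hK
  rw [← Submodule.orthogonal_eq_bot_iff]
  by_contra hne
  have hinv : ∀ x ∈ Kᗮ, V.toLinearMap x ∈ Kᗮ := by
    intro x hx
    rw [hK, Submodule.mem_orthogonal]
    intro u hu
    induction hu using Submodule.span_induction with
    | mem v hv =>
      obtain ⟨z, hz, hv'⟩ := hv
      have h0 : ⟪v, x⟫_ℂ = 0 :=
        (Submodule.mem_orthogonal _ _).1 hx v (Submodule.subset_span ⟨z, hz, hv'⟩)
      rw [← V.inner_map_map, hv', inner_smul_left] at h0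
      have hz0 : z ≠ 0 := by rintro rfl; simp at hz
      simpa [hz0] using h0
    | zero => simp
    | add a b _ _ ha hb => rw [inner_add_left, ha, hb, add_zero]
    | smul a b _ hb => rw [inner_smul_left, hb, mul_zero]
  have : Nontrivial Kᗮ := Submodule.nontrivial_iff_ne_bot.2 hne
  obtain ⟨z, hz⟩ := Module.End.exists_eigenvalue (V.toLinearMap.restrict hinv)
  obtain ⟨x, hx⟩ := hz.exists_hasEigenvector
  have hVx : V x = z • (x : W) := by
    have := congrArg Subtype.val hx.apply_eq_smul
    simpa using this
  have hx0 : (x : W) ≠ 0 := fun h => hx.2 (Subtype.ext h)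
  have hz1 : ‖z‖ = 1 := by
    have h := V.norm_map x
    rw [hVx, norm_smul] at h
    exact mul_right_cancel₀ (norm_ne_zero_iff.2 hx0) (by rw [h, one_mul])
  have hmem : (x : W) ∈ K := Submodule.subset_span ⟨z, hz1, hVx⟩
  exact hx0 (inner_self_eq_zero.1 ((Submodule.mem_orthogonal _ _).1 x.2 _ hmem))

/-- If `Φ Z Φ† = E Z E†` and `Yr Z Yr† = 0` for a nonzero `Z ⪰ 0`, then the pencil `z E - Φ` has an
eigenvector in the kernel of `Yr` for an eigenvalue on the unit circle. -/
theorem exists_unimodular_eigenvector_of_isPositive (E Φ : W →L[ℂ] X) (Yr : W →L[ℂ] Y)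
    {Z : W →L[ℂ] W} (hZ : Z.IsPositive) (hZ0 : Z ≠ 0)
    (hEΦ : ∀ x, (⟪Z (adjoint Φ x), adjoint Φ x⟫_ℂ).re = (⟪Z (adjoint E x), adjoint E x⟫_ℂ).re)
    (hY : ∀ y, (⟪Z (adjoint Yr y), adjoint Yr y⟫_ℂ).re = 0) :
    ∃ (z : ℂ) (w : W), ‖z‖ = 1 ∧ w ≠ 0 ∧ Φ w = z • E w ∧ Yr w = 0 := by
  -- With `Z = R† R` the hypotheses say that `R E† x` and `R Φ† x` have equal norms and that `R Yr†
  -- = 0`. Hence `R E† x ↦ R Φ† x` is a well-defined isometry on a subspace, which extends to an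
  -- isometry `V` of `W`.
  obtain ⟨R, hR⟩ := CStarAlgebra.nonneg_iff_eq_star_mul_self.1
    ((ContinuousLinearMap.nonneg_iff_isPositive Z).2 hZ)
  have hnorm : ∀ w, (⟪Z w, w⟫_ℂ).re = ‖R w‖ ^ 2 := by
    intro w
    rw [hR, ContinuousLinearMap.star_eq_adjoint]
    change (⟪adjoint R (R w), w⟫_ℂ).re = _
    rw [ContinuousLinearMap.adjoint_inner_left, inner_self_eq_norm_sq_to_K]
    norm_cast
  have hiso : ∀ x, ‖R (adjoint Φ x)‖ = ‖R (adjoint E x)‖ := by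
    intro x
    have := hEΦ x
    rw [hnorm, hnorm] at this
    exact (sq_eq_sq₀ (norm_nonneg _) (norm_nonneg _)).1 this
  have hRY : ∀ y, R (adjoint Yr y) = 0 := by
    intro y
    have := hY y
    rw [hnorm] at this
    simpa using this
  let N : X →ₗ[ℂ] W := (R ∘L adjoint E).toLinearMap
  let M : X →ₗ[ℂ] W := (R ∘L adjoint Φ).toLinearMap
  have hker : LinearMap.ker N ≤ LinearMap.ker M := by
    intro x hx
    rw [LinearMap.mem_ker] at hx ⊢
    have := hiso x
    change R (adjoint E x) = 0 at hx
    change R (adjoint Φ x) = 0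
    rw [hx, norm_zero, norm_eq_zero] at this
    exact this
  let T : LinearMap.range N →ₗ[ℂ] W :=
    ((LinearMap.ker N).liftQ M hker) ∘ₗ N.quotKerEquivRange.symm.toLinearMap
  have hT : ∀ x, T ⟨N x, LinearMap.mem_range_self N x⟩ = M x := by
    intro x
    have : N.quotKerEquivRange.symm ⟨N x, LinearMap.mem_range_self N x⟩
        = (LinearMap.ker N).mkQ x := by
      rw [LinearEquiv.symm_apply_eq]
      rfl
    simp [T, this]
  let T' : LinearMap.range N →ₗᵢ[ℂ] W := ⟨T, by
    rintro ⟨_, x, rfl⟩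
    rw [hT]
    exact hiso x⟩
  let V := T'.extend
  have hV : ∀ x, V (R (adjoint E x)) = R (adjoint Φ x) := by
    intro x
    have h := T'.extend_apply ⟨N x, LinearMap.mem_range_self N x⟩
    exact h.trans (hT x)
  have hR0 : adjoint R ≠ (0 : W →L[ℂ] W) := by
    intro h
    apply hZ0
    rw [hR, ContinuousLinearMap.star_eq_adjoint, h, zero_mul]
  obtain ⟨v, ⟨z, hz, hv⟩, hRv⟩ : ∃ v ∈ {v | ∃ z : ℂ, ‖z‖ = 1 ∧ V v = z • v}, adjoint R v ≠ 0 := by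
    by_contra! hcon
    apply hR0
    have hle : Submodule.span ℂ {v | ∃ z : ℂ, ‖z‖ = 1 ∧ V v = z • v}
        ≤ LinearMap.ker (adjoint R).toLinearMap := Submodule.span_le.2 fun v hv => hcon v hv
    rw [V.span_eigenvectors_eq_top] at hle
    ext v
    exact hle (Submodule.mem_top (x := v))
  have hz0 : z ≠ 0 := by rintro rfl; simp at hz
  -- The eigenvalue is inverted because `V` intertwines the adjoints: `⟪Φ R† v, x⟫ = ⟪v, V R E† x⟫`,
  -- while `⟪V v, V R E† x⟫ = ⟪E R† v, x⟫`.
  refine ⟨z⁻¹, adjoint R v, by simp [hz], hRv, ?_, ?_⟩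
  · refine ext_inner_right ℂ fun x => ?_
    rw [← ContinuousLinearMap.adjoint_inner_right, ContinuousLinearMap.adjoint_inner_left, ← hV,
      inner_smul_left, ← ContinuousLinearMap.adjoint_inner_right E,
      ContinuousLinearMap.adjoint_inner_left]
    have h := V.inner_map_map v (R (adjoint E x))
    rw [hv, inner_smul_left] at h
    rw [← h, ← mul_assoc, map_inv₀, inv_mul_cancel₀ (by simpa using hz0), one_mul]
  · refine ext_inner_right ℂ fun y => ?_
    rw [← ContinuousLinearMap.adjoint_inner_right, ContinuousLinearMap.adjoint_inner_left, hRY]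
    simp

end Pencil

/-! ### Strict dissipation by separation of convex sets -/

section Storage

open scoped InnerProductSpace
open InnerProductSpace ContinuousLinearMap

variable {W : Type*} [NormedAddCommGroup W] [InnerProductSpace ℂ W]

/-- A complex subspace disjoint from an open convex set lies in the kernel of a functional whose
real part is negative on that set. -/
theorem exists_dual_neg_of_disjoint_submodule {V : Type*} [NormedAddCommGroup V] [NormedSpace ℂ V]
    [Module ℝ V] [IsScalarTower ℝ ℂ V] {s : Set V} (hs : Convex ℝ s) (hso : IsOpen s)
    (L : Submodule ℂ V) (hdisj : ∀ v ∈ L, v ∉ s) :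
    ∃ f : V →L[ℂ] ℂ, (∀ v ∈ s, (f v).re < 0) ∧ ∀ v ∈ L, f v = 0 := by
  obtain ⟨f, u, hfu, huf⟩ := RCLike.geometric_hahn_banach_open (𝕜 := ℂ) hs hso
    (L.restrictScalars ℝ).convex (Set.disjoint_left.2 fun v hv hL => hdisj v hL hv)
  have huL : ∀ v ∈ L, u ≤ (f v).re := huf
  have hu : u ≤ 0 := by simpa using huL 0 L.zero_mem
  refine ⟨f, fun v hv => (hfu v hv).trans_le hu, fun v hv => ?_⟩
  by_contra hne
  -- This multiple of `v` stays in `L` but has `f`-value `u - 1`, below the separating level.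
  have := huL _ (L.smul_mem ((u - 1 : ℝ) / f v) hv)
  rw [map_smul, smul_eq_mul, div_mul_cancel₀ _ hne, Complex.ofReal_re] at this
  linarith

/-- The operators on `W` whose Hermitian part is positive definite. -/
def coerciveOperators (W : Type*) [NormedAddCommGroup W] [InnerProductSpace ℂ W] :
    Set (W →L[ℂ] W) :=
  {T | ∃ c : ℝ, 0 < c ∧ ∀ w, c * ‖w‖ ^ 2 ≤ (⟪T w, w⟫_ℂ).re}

theorem isOpen_coerciveOperators : IsOpen (coerciveOperators W) := by
  rw [Metric.isOpen_iff]
  rintro T ⟨c, hc, hT⟩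
  refine ⟨c / 2, half_pos hc, fun T' hT' => ⟨c / 2, half_pos hc, fun w => ?_⟩⟩
  have h1 : ‖(T' - T) w‖ ≤ c / 2 * ‖w‖ :=
    ((T' - T).le_opNorm w).trans (by
      rw [← dist_eq_norm]
      exact mul_le_mul_of_nonneg_right (Metric.mem_ball.1 hT').le (norm_nonneg _))
  have h2 : |(⟪(T' - T) w, w⟫_ℂ).re| ≤ c / 2 * ‖w‖ ^ 2 :=
    (Complex.abs_re_le_norm _).trans ((norm_inner_le_norm _ _).trans (by
      nlinarith [norm_nonneg w, h1]))
  have h3 : (⟪T' w, w⟫_ℂ).re = (⟪T w, w⟫_ℂ).re + (⟪(T' - T) w, w⟫_ℂ).re := by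
    rw [← Complex.add_re, ← inner_add_left]
    simp
  have := hT w
  rw [abs_le] at h2
  linarith [h2.1]

theorem convex_coerciveOperators : Convex ℝ (coerciveOperators W) := by
  rw [convex_iff_forall_pos]
  rintro S ⟨c, hc, hS⟩ T ⟨d, hd, hT⟩ a b ha hb -
  refine ⟨a * c + b * d, by positivity, fun w => ?_⟩
  have : (⟪(a • S + b • T) w, w⟫_ℂ).re = a * (⟪S w, w⟫_ℂ).re + b * (⟪T w, w⟫_ℂ).re := by
    simp [← Complex.coe_smul, mul_comm]
  rw [this]
  nlinarith [mul_le_mul_of_nonneg_left (hS w) ha.le, mul_le_mul_of_nonneg_left (hT w) hb.le]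

theorem exists_dual_neg_on_coerciveOperators (L : Submodule ℂ (W →L[ℂ] W))
    (hL : ∀ T ∈ L, T ∉ coerciveOperators W) :
    ∃ f : (W →L[ℂ] W) →L[ℂ] ℂ, (∀ T ∈ coerciveOperators W, (f T).re < 0) ∧ ∀ T ∈ L, f T = 0 :=
  exists_dual_neg_of_disjoint_submodule (V := W →L[ℂ] W) convex_coerciveOperators
    isOpen_coerciveOperators L hL

variable {X Y : Type*} [FiniteDimensional ℂ W]
  [NormedAddCommGroup X] [InnerProductSpace ℂ X] [FiniteDimensional ℂ X]
  [NormedAddCommGroup Y] [InnerProductSpace ℂ Y] [FiniteDimensional ℂ Y]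

/-- A functional that is negative on all coercive operators is, up to sign, given by a nonzero
positive operator. -/
theorem exists_isPositive_of_neg_on_coerciveOperators (f : (W →L[ℂ] W) →L[ℂ] ℂ)
    (hf : ∀ T ∈ coerciveOperators W, (f T).re < 0) :
    ∃ Z : W →L[ℂ] W, Z.IsPositive ∧ Z ≠ 0 ∧
      ∀ v w, ⟪Z w, v⟫_ℂ = -f (rankOne ℂ v w) := by
  let B : W →L⋆[ℂ] W →L[ℂ] ℂ :=
    (ContinuousLinearMap.compL ℂ W (W →L[ℂ] W) ℂ (-f)).comp (rankOne ℂ (E := W) (F := W)).flip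
  have hB : ∀ v w, ⟪continuousLinearMapOfBilin B w, v⟫_ℂ = -f (rankOne ℂ v w) := by
    intro v w
    rw [continuousLinearMapOfBilin_apply]
    rfl
  have hone : (1 : W →L[ℂ] W) ∈ coerciveOperators W :=
    ⟨1, one_pos, fun w => by
      rw [one_apply_eq_self, inner_self_eq_norm_sq_to_K, one_mul]
      norm_cast⟩
  -- A semidefinite `T` is the limit of the coercive `T + ε`. Were the value positive, a suitable
  -- `ε` would make `f (T + ε)` have real part exactly `0`.
  have hlim : ∀ T : W →L[ℂ] W, (∀ w, 0 ≤ (⟪T w, w⟫_ℂ).re) → (f T).re ≤ 0 := by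
    intro T hT
    have hmem : ∀ ε : ℝ, 0 < ε → (f T).re + ε * (f 1).re < 0 := by
      intro ε hε
      have := hf (T + (ε : ℂ) • 1) ⟨ε, hε, fun w => by
        have h1 : (⟪(T + (ε : ℂ) • (1 : W →L[ℂ] W)) w, w⟫_ℂ).re
            = (⟪T w, w⟫_ℂ).re + ε * ‖w‖ ^ 2 := by
          simp only [_root_.add_apply, _root_.smul_apply,
            one_apply_eq_self, inner_add_left, inner_smul_left, Complex.conj_ofReal,
            inner_self_eq_norm_sq_to_K, Complex.add_re, Complex.re_ofReal_mul]
          norm_cast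
        rw [h1]
        linarith [hT w]⟩
      simpa using this
    have h1 := hf 1 hone
    by_contra! hpos
    have := hmem ((f T).re / -(f 1).re) (div_pos hpos (by linarith))
    have h2 : (f T).re / -(f 1).re * (f 1).re = -(f T).re := by
      rw [div_neg, neg_mul, div_mul_cancel₀ _ h1.ne]
    linarith
  refine ⟨continuousLinearMapOfBilin B, ?_, ?_, hB⟩
  · rw [ContinuousLinearMap.isPositive_iff_complex]
    intro w
    rw [hB]
    have hin : ∀ u, ⟪rankOne ℂ w w u, u⟫_ℂ = ((‖⟪w, u⟫_ℂ‖ ^ 2 : ℝ) : ℂ) := by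
      intro u
      rw [rankOne_apply, inner_smul_left, mul_comm, Complex.mul_conj, Complex.normSq_eq_norm_sq]
    have hre : (f (rankOne ℂ w w)).re ≤ 0 := hlim _ fun u => by
      rw [hin]
      rw [Complex.ofReal_re]
      positivity
    -- The forms of `± i w w†` have zero real part, so `hlim` applies to both signs and makes `f (w
    -- w†)` real.
    have him1 := hlim (Complex.I • rankOne ℂ w w) fun u => by
      rw [_root_.smul_apply, inner_smul_left, hin, Complex.re_mul_ofReal]
      simp
    have him2 := hlim (-(Complex.I • rankOne ℂ w w)) fun u => by
      rw [_root_.neg_apply, _root_.smul_apply, inner_neg_left,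
        inner_smul_left, hin, Complex.neg_re, Complex.re_mul_ofReal]
      simp
    simp only [map_smul, map_neg, smul_eq_mul, Complex.neg_re, Complex.I_mul_re] at him1 him2
    constructor
    · apply Complex.ext
      · simp
      · simp
        linarith
    · simpa using hre
  · intro hZ
    -- The identity is a sum of rank-one operators, so `Z = 0` would force `f 1 = 0`.
    have hsum : (1 : W →L[ℂ] W) = ∑ i, rankOne ℂ (stdOrthonormalBasis ℂ W i)
        (stdOrthonormalBasis ℂ W i) := by
      ext w
      simp [_root_.sum_apply, (stdOrthonormalBasis ℂ W).sum_repr']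
    have hf0 : f 1 = 0 := by
      rw [hsum, map_sum]
      refine Finset.sum_eq_zero fun i _ => neg_eq_zero.1 ?_
      rw [← hB, hZ]
      simp
    have := hf 1 hone
    simp [hf0] at this

/-- If the pencil `z E - Φ` has no eigenvector in the kernel of `Yr` for an eigenvalue on the unit
circle, then `P` and `γ` can be chosen with `Φ† P Φ - E† P E + γ Yr† Yr` positive definite. -/
theorem exists_coercive_storage (E Φ : W →L[ℂ] X) (Yr : W →L[ℂ] Y)
    (h : ∀ (z : ℂ) (w : W), ‖z‖ = 1 → Φ w = z • E w → Yr w = 0 → w = 0) :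
    ∃ (P : X →L[ℂ] X) (γ c : ℝ), 0 < c ∧ ∀ w, c * ‖w‖ ^ 2 ≤
      (⟪P (Φ w), Φ w⟫_ℂ).re - (⟪P (E w), E w⟫_ℂ).re + γ * ‖Yr w‖ ^ 2 := by
  -- Replacing the scalar `γ` by an arbitrary operator `G` makes the dual condition on `Yr` separate
  -- for each rank-one test operator; `γ = ‖G‖` is recovered at the end.
  let Q : ((X →L[ℂ] X) × (Y →L[ℂ] Y)) →ₗ[ℂ] (W →L[ℂ] W) :=
    { toFun := fun q =>
        adjoint Φ ∘L q.1 ∘L Φ - adjoint E ∘L q.1 ∘L E + adjoint Yr ∘L q.2 ∘L Yr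
      map_add' := fun q q' => by
        ext w
        simp
        abel
      map_smul' := fun a q => by
        ext w
        simp [smul_sub] }
  have hQ : ∀ P G w, Q (P, G) w =
      adjoint Φ (P (Φ w)) - adjoint E (P (E w)) + adjoint Yr (G (Yr w)) := fun _ _ _ => rfl
  clear_value Q
  by_cases hdisj : ∀ T ∈ LinearMap.range Q, T ∉ coerciveOperators W
  · exfalso
    obtain ⟨f, hf, hfL⟩ := exists_dual_neg_on_coerciveOperators (LinearMap.range Q) hdisj
    have hfQ : ∀ q, f (Q q) = 0 := fun q => hfL _ (LinearMap.mem_range_self Q q)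
    obtain ⟨Z, hZ, hZ0, hZf⟩ := exists_isPositive_of_neg_on_coerciveOperators f hf
    obtain ⟨z, w, hz, hw, h1, h2⟩ := exists_unimodular_eigenvector_of_isPositive E Φ Yr hZ hZ0
      (fun x => by
        have := hfQ (rankOne ℂ x x, 0)
        have hval : Q (rankOne ℂ x x, 0) = rankOne ℂ (adjoint Φ x) (adjoint Φ x)
            - rankOne ℂ (adjoint E x) (adjoint E x) := by
          ext w
          simp [hQ, adjoint_inner_left]
        rw [hval, map_sub, sub_eq_zero] at this
        rw [hZf, hZf, this])
      (fun y => by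
        have := hfQ (0, rankOne ℂ y y)
        have hval : Q (0, rankOne ℂ y y) = rankOne ℂ (adjoint Yr y) (adjoint Yr y) := by
          ext w
          simp [hQ, adjoint_inner_left]
        rw [hval] at this
        rw [hZf, this, neg_zero, Complex.zero_re])
    exact hw (h z w hz h1 h2)
  · push Not at hdisj
    obtain ⟨_, ⟨⟨P, G⟩, rfl⟩, c, hc, hT⟩ := hdisj
    refine ⟨P, ‖G‖, c, hc, fun w => (hT w).trans ?_⟩
    rw [hQ, inner_add_left, inner_sub_left, adjoint_inner_left, adjoint_inner_left,
      adjoint_inner_left, Complex.add_re, Complex.sub_re]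
    gcongr
    refine (Complex.re_le_norm _).trans ((norm_inner_le_norm _ _).trans ?_)
    nlinarith [G.le_opNorm (Yr w), norm_nonneg (Yr w)]

end Storage

/-! ### Jordan chains on the detector kernel and their deflation -/

section Chains

open scoped InnerProductSpace
open InnerProductSpace ContinuousLinearMap

variable {W X Y : Type*}
  [NormedAddCommGroup W] [InnerProductSpace ℂ W]
  [NormedAddCommGroup X] [InnerProductSpace ℂ X]
  [NormedAddCommGroup Y] [InnerProductSpace ℂ Y]

/-- The last vectors of the Jordan chains of length `k` at `z` of the pencil `z E - Φ` restricted
to the kernel of `Yr`. -/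
def chainSpace (E Φ : W →L[ℂ] X) (Yr : W →L[ℂ] Y) (z : ℂ) : ℕ → Submodule ℂ W
  | 0 => ⊥
  | k + 1 => LinearMap.ker Yr.toLinearMap ⊓
      ((chainSpace E Φ Yr z k).map E.toLinearMap).comap (z • E - Φ).toLinearMap

variable {E Φ : W →L[ℂ] X} {Yr : W →L[ℂ] Y} {z : ℂ}

theorem mem_chainSpace_zero {w : W} : w ∈ chainSpace E Φ Yr z 0 ↔ w = 0 := Submodule.mem_bot ℂ

theorem mem_chainSpace_succ {k : ℕ} {w : W} : w ∈ chainSpace E Φ Yr z (k + 1) ↔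
    Yr w = 0 ∧ ∃ u ∈ chainSpace E Φ Yr z k, E u = z • E w - Φ w := Iff.rfl

/-- Chains may start with zero vectors, so a short chain can be padded. -/
theorem chainSpace_le_succ (k : ℕ) :
    chainSpace E Φ Yr z k ≤ chainSpace E Φ Yr z (k + 1) := by
  induction k with
  | zero => exact bot_le
  | succ k ih =>
    intro w hw
    rw [mem_chainSpace_succ] at hw ⊢
    obtain ⟨h, u, hu, hE⟩ := hw
    exact ⟨h, u, ih hu, hE⟩

theorem mem_chainSpace_of_eigenvector {w : W} (hw : Φ w = z • E w) (hY : Yr w = 0) (k : ℕ) :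
    w ∈ chainSpace E Φ Yr z (k + 1) := by
  rw [mem_chainSpace_succ]
  exact ⟨hY, 0, Submodule.zero_mem _, by simp [hw]⟩

section Deflation

variable {W' : Type*} [NormedAddCommGroup W'] [InnerProductSpace ℂ W']
  {ι : W' →L[ℂ] W} {π : X →L[ℂ] X} {z₀ : ℂ} {w₀ : W}

/-- Chains of the pencil deflated by the eigenvector `w₀` at `z₀` lift, up to multiples of `w₀`,
to chains at every `z ≠ z₀`. -/
theorem exists_mem_chainSpace_of_deflated_ne (hΦ : Φ w₀ = z₀ • E w₀) (hY : Yr w₀ = 0)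
    (hπ : ∀ x, π x = 0 → ∃ c : ℂ, x = c • E w₀) (hz : z ≠ z₀) {k : ℕ} {w : W'}
    (hw : w ∈ chainSpace (π ∘L E ∘L ι) (π ∘L Φ ∘L ι) (Yr ∘L ι) z k) :
    ∃ a : ℂ, ι w + a • w₀ ∈ chainSpace E Φ Yr z k := by
  induction k generalizing w with
  | zero =>
    rw [mem_chainSpace_zero] at hw
    exact ⟨0, by simp [hw]⟩
  | succ k ih =>
    obtain ⟨hYw, u, hu, hE⟩ := mem_chainSpace_succ.1 hw
    obtain ⟨a, ha⟩ := ih hu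
    simp only [ContinuousLinearMap.comp_apply] at hE hYw
    obtain ⟨c, hc⟩ := hπ (z • E (ι w) - Φ (ι w) - E (ι u)) (by simp [hE])
    -- Adding `b • w₀` changes `z E - Φ` by `b (z - z₀) E w₀`; this `b` repairs the multiple of `E
    -- w₀` lost under `π`.
    refine ⟨(a - c) / (z - z₀), mem_chainSpace_succ.2 ⟨by simp [hYw, hY], _, ha, ?_⟩⟩
    have hzz : z - z₀ ≠ 0 := sub_ne_zero.2 hz
    have h1 : z • E (ι w) - Φ (ι w) = E (ι u) + c • E w₀ := by rw [← hc]; abel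
    have h2 : (z - z₀) • ((a - c) / (z - z₀)) • E w₀ = (a - c) • E w₀ := by
      rw [smul_smul, mul_div_cancel₀ _ hzz]
    calc E (ι u + a • w₀) = (E (ι u) + c • E w₀) + (a - c) • E w₀ := by
          rw [map_add, map_smul, sub_smul]; abel
      _ = z • E (ι w + ((a - c) / (z - z₀)) • w₀) - Φ (ι w + ((a - c) / (z - z₀)) • w₀) := by
          rw [← h1, ← h2, map_add, map_add, map_smul, map_smul, hΦ]
          module

/-- At `z₀` itself the last vector cannot be corrected by `w₀`. The lost multiple of `E w₀` goes
into the preceding vector instead, at the price of one more link in the chain. -/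
theorem mem_chainSpace_of_deflated (hΦ : Φ w₀ = z₀ • E w₀) (hY : Yr w₀ = 0)
    (hπ : ∀ x, π x = 0 → ∃ c : ℂ, x = c • E w₀) {k : ℕ} {w : W'}
    (hw : w ∈ chainSpace (π ∘L E ∘L ι) (π ∘L Φ ∘L ι) (Yr ∘L ι) z₀ k) :
    ι w ∈ chainSpace E Φ Yr z₀ (k + 1) := by
  induction k generalizing w with
  | zero =>
    rw [mem_chainSpace_zero] at hw
    simp [hw]
  | succ k ih =>
    obtain ⟨hYw, u, hu, hE⟩ := mem_chainSpace_succ.1 hw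
    simp only [ContinuousLinearMap.comp_apply] at hE hYw
    obtain ⟨c, hc⟩ := hπ (z₀ • E (ι w) - Φ (ι w) - E (ι u)) (by simp [hE])
    refine mem_chainSpace_succ.2 ⟨hYw, ι u + c • w₀, Submodule.add_mem _ (ih hu)
      (Submodule.smul_mem _ _ (mem_chainSpace_of_eigenvector hΦ hY k)), ?_⟩
    rw [map_add, map_smul, ← hc]
    abel

end Deflation

end Chains

/-! ### Storage functions by induction on the dimension -/

section Storage

open scoped InnerProductSpace
open InnerProductSpace ContinuousLinearMap

universe u

variable {X Y Y' : Type*}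
  [NormedAddCommGroup X] [InnerProductSpace ℂ X] [FiniteDimensional ℂ X]
  [NormedAddCommGroup Y] [InnerProductSpace ℂ Y] [FiniteDimensional ℂ Y]
  [NormedAddCommGroup Y'] [InnerProductSpace ℂ Y']

/-- The coercive form, scaled by `‖Yp‖² / c`, dominates `‖Yp w‖²`; moving the storage terms across
flips the sign of `P`. -/
theorem exists_storage_of_no_unimodular_eigenvector {W : Type u} [NormedAddCommGroup W]
    [InnerProductSpace ℂ W] [FiniteDimensional ℂ W] (E Φ : W →L[ℂ] X) (Yr : W →L[ℂ] Y)
    (Yp : W →L[ℂ] Y')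
    (h : ∀ (z : ℂ) (w : W), ‖z‖ = 1 → Φ w = z • E w → Yr w = 0 → w = 0) :
    ∃ (P : X →L[ℂ] X) (γ : ℝ), ∀ w,
      (⟪P (Φ w), Φ w⟫_ℂ).re - (⟪P (E w), E w⟫_ℂ).re + ‖Yp w‖ ^ 2 ≤ γ * ‖Yr w‖ ^ 2 := by
  obtain ⟨P, γ, c, hc, hP⟩ := exists_coercive_storage E Φ Yr h
  set C := ‖Yp‖ ^ 2 / c with hC
  refine ⟨-((C : ℂ) • P), C * γ, fun w => ?_⟩
  have h1 : ∀ x, (⟪(-((C : ℂ) • P)) x, x⟫_ℂ).re = -(C * (⟪P x, x⟫_ℂ).re) := by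
    intro x
    rw [_root_.neg_apply, _root_.smul_apply, inner_neg_left, inner_smul_left,
      Complex.conj_ofReal, Complex.neg_re, Complex.re_ofReal_mul]
  have h2 : ‖Yp w‖ ^ 2 ≤ C * (c * ‖w‖ ^ 2) := by
    rw [hC, ← mul_assoc, div_mul_cancel₀ _ hc.ne', ← mul_pow]
    gcongr
    exact Yp.le_opNorm w
  have h3 := mul_le_mul_of_nonneg_left (hP w) (show 0 ≤ C by positivity)
  rw [h1, h1]
  linarith

/-- If `Yp` vanishes on all chains at points of the unit circle of the pencil `z E - Φ` restricted
to the kernel of `Yr`, then the dissipation inequality is solvable. -/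
theorem exists_storage_of_chainSpace_le_ker {W : Type u} [NormedAddCommGroup W]
    [InnerProductSpace ℂ W] [FiniteDimensional ℂ W] (E Φ : W →L[ℂ] X) (Yr : W →L[ℂ] Y)
    (Yp : W →L[ℂ] Y')
    (h : ∀ (z : ℂ) (k : ℕ), ‖z‖ = 1 → ∀ w ∈ chainSpace E Φ Yr z k, Yp w = 0) :
    ∃ (P : X →L[ℂ] X) (γ : ℝ), ∀ w,
      (⟪P (Φ w), Φ w⟫_ℂ).re - (⟪P (E w), E w⟫_ℂ).re + ‖Yp w‖ ^ 2 ≤ γ * ‖Yr w‖ ^ 2 := by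
  induction hn : Module.finrank ℂ W using Nat.strong_induction_on generalizing W with
  | _ n ih =>
  by_cases hno : ∀ (z : ℂ) (w : W), ‖z‖ = 1 → Φ w = z • E w → Yr w = 0 → w = 0
  · exact exists_storage_of_no_unimodular_eigenvector E Φ Yr Yp hno
  push Not at hno
  obtain ⟨z₀, w₀, hz₀, hΦ, hY, hw₀⟩ := hno
  have hYp : Yp w₀ = 0 := h z₀ 1 hz₀ w₀ (mem_chainSpace_of_eigenvector hΦ hY 0)
  let K : Submodule ℂ W := (Submodule.span ℂ {w₀})ᗮ
  let π : X →L[ℂ] X := (Submodule.span ℂ {E w₀})ᗮ.starProjection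
  have hπ0 : π (E w₀) = 0 := by
    rw [Submodule.starProjection_apply_eq_zero_iff, Submodule.orthogonal_orthogonal]
    exact Submodule.mem_span_singleton_self _
  have hπ : ∀ x, π x = 0 → ∃ c : ℂ, x = c • E w₀ := by
    intro x hx
    rw [Submodule.starProjection_apply_eq_zero_iff, Submodule.orthogonal_orthogonal,
      Submodule.mem_span_singleton] at hx
    obtain ⟨c, hc⟩ := hx
    exact ⟨c, hc.symm⟩
  have hdim : Module.finrank ℂ K < n := by
    have h1 := (Submodule.span ℂ {w₀}).finrank_add_finrank_orthogonal
    rw [finrank_span_singleton hw₀, hn] at h1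
    change 1 + Module.finrank ℂ K = n at h1
    omega
  obtain ⟨P, γ, hP⟩ := ih _ hdim (π ∘L E ∘L K.subtypeL)
    (π ∘L Φ ∘L K.subtypeL) (Yr ∘L K.subtypeL) (Yp ∘L K.subtypeL) (by
      intro z k hz w hw
      by_cases hzz : z = z₀
      · subst hzz
        exact h z (k + 1) hz _ (mem_chainSpace_of_deflated hΦ hY hπ hw)
      · obtain ⟨a, ha⟩ := exists_mem_chainSpace_of_deflated_ne hΦ hY hπ hzz hw
        have := h z k hz _ ha
        simpa [hYp] using this) rfl
  -- Since `π` kills `E w₀` and `Φ w₀`, and both outputs vanish at `w₀`, only the component of `w`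
  -- orthogonal to `w₀` contributes.
  refine ⟨adjoint π ∘L P ∘L π, γ, fun w => ?_⟩
  obtain ⟨y, hy, v, hv, rfl⟩ := (Submodule.span ℂ {w₀}).exists_add_mem_mem_orthogonal w
  obtain ⟨a, rfl⟩ := Submodule.mem_span_singleton.1 hy
  have hin : ∀ x, ⟪(adjoint π ∘L P ∘L π) x, x⟫_ℂ = ⟪P (π x), π x⟫_ℂ := by
    intro x
    rw [ContinuousLinearMap.comp_apply, adjoint_inner_left, ContinuousLinearMap.comp_apply]
  have hPv := hP ⟨v, hv⟩
  simp only [ContinuousLinearMap.comp_apply, Submodule.subtypeL_apply] at hPv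
  rw [hin, hin]
  simpa [hΦ, hπ0, hY, hYp] using hPv

end Storage

/-! ### Real matrices acting on complex vectors -/

section RealComplex

variable {a b : Type*} [Fintype b]

theorem re_map_ofReal_mulVec (M : Matrix a b ℝ) (w : b → ℂ) (i : a) :
    ((M.map Complex.ofReal *ᵥ w) i).re = (M *ᵥ fun j => (w j).re) i := by
  simp [Matrix.mulVec, dotProduct]

theorem im_map_ofReal_mulVec (M : Matrix a b ℝ) (w : b → ℂ) (i : a) :
    ((M.map Complex.ofReal *ᵥ w) i).im = (M *ᵥ fun j => (w j).im) i := by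
  simp [Matrix.mulVec, dotProduct]

theorem map_ofReal_mulVec_ofReal (M : Matrix a b ℝ) (w : b → ℝ) :
    (M.map Complex.ofReal *ᵥ fun j => (w j : ℂ)) = fun i => ((M *ᵥ w) i : ℂ) := by
  ext i
  simp [Matrix.mulVec, dotProduct]

theorem sum_norm_sq_map_ofReal_mulVec [Fintype a] (M : Matrix a b ℝ) (w : b → ℂ) :
    ∑ i, ‖(M.map Complex.ofReal *ᵥ w) i‖ ^ 2 =
      (M *ᵥ fun j => (w j).re) ⬝ᵥ (M *ᵥ fun j => (w j).re) +
        (M *ᵥ fun j => (w j).im) ⬝ᵥ (M *ᵥ fun j => (w j).im) := by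
  simp only [dotProduct, ← Finset.sum_add_distrib]
  refine Finset.sum_congr rfl fun i _ => ?_
  rw [Complex.sq_norm, Complex.normSq_apply, re_map_ofReal_mulVec, im_map_ofReal_mulVec]

/-- The cross terms from the real and imaginary parts cancel. For `‖z‖ = 1` this removes the storage
from the dissipation inequality. -/
theorem Matrix.quadForm_re_add_quadForm_im_smul (P : Matrix b b ℝ) (z : ℂ) (x : b → ℂ) :
    (fun j => ((z • x) j).re) ⬝ᵥ (P *ᵥ fun j => ((z • x) j).re) +
        (fun j => ((z • x) j).im) ⬝ᵥ (P *ᵥ fun j => ((z • x) j).im) =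
      ‖z‖ ^ 2 * ((fun j => (x j).re) ⬝ᵥ (P *ᵥ fun j => (x j).re) +
        (fun j => (x j).im) ⬝ᵥ (P *ᵥ fun j => (x j).im)) := by
  have hre : (fun j => ((z • x) j).re) = z.re • (fun j => (x j).re) - z.im • fun j => (x j).im := by
    ext j
    simp
  have him : (fun j => ((z • x) j).im) = z.re • (fun j => (x j).im) + z.im • fun j => (x j).re := by
    ext j
    simp
  rw [hre, him, Complex.sq_norm, Complex.normSq_apply]
  simp only [Matrix.mulVec_sub, Matrix.mulVec_add, Matrix.mulVec_smul, sub_dotProduct,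
    dotProduct_sub, add_dotProduct, dotProduct_add, smul_dotProduct, dotProduct_smul, smul_eq_mul]
  ring

theorem dotProduct_transpose_mul_mulVec [Fintype a] (M N : Matrix a b ℝ) (v : b → ℝ) :
    v ⬝ᵥ ((Mᵀ * N) *ᵥ v) = (M *ᵥ v) ⬝ᵥ (N *ᵥ v) := by
  rw [← Matrix.mulVec_mulVec, Matrix.dotProduct_mulVec, Matrix.vecMul_transpose]

end RealComplex

/-! ### The matrix inequality as a dissipation inequality -/

namespace ClosedLoop

variable {n m p r : Type*} [Fintype n] [Fintype p] [Fintype r]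

theorem isSymm_lmiMatrix (S : ClosedLoop n m p r) (γ : ℝ) {P : Matrix n n ℝ} (hP : P.IsSymm) :
    (S.lmiMatrix γ P).IsSymm := by
  have hP' : Pᵀ = P := hP
  rw [Matrix.IsSymm, lmiMatrix, Matrix.transpose_sub, Matrix.transpose_add,
    Matrix.fromBlocks_transpose, Matrix.transpose_smul, Matrix.transpose_mul (_ᵀ),
    Matrix.transpose_mul (_ᵀ), Matrix.transpose_transpose, Matrix.transpose_transpose]
  congr 3 <;> simp [Matrix.transpose_mul, hP', Matrix.mul_assoc]

/-- The constraint `γ ≥ 0` excludes `⊥`, so the only non-real value is the `⊤` of an infeasible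
program. -/
theorem exists_sdpValue_eq_coe_iff (S : ClosedLoop n m p r) :
    (∃ v : ℝ, S.sdpValue = (v : EReal)) ↔ ∃ γ P, S.Feasible γ P := by
  constructor
  · rintro ⟨v, hv⟩
    by_contra! hno
    have : S.sdpValue = ⊤ := by
      rw [sdpValue, sInf_eq_top]
      rintro _ ⟨γ, P, h, -⟩
      exact absurd h (hno γ P)
    rw [this] at hv
    exact EReal.coe_ne_top v hv.symm
  · rintro ⟨γ, P, h⟩
    have hle : S.sdpValue ≤ (γ : EReal) := sInf_le ⟨γ, P, h, rfl⟩
    have hge : (0 : EReal) ≤ S.sdpValue := by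
      refine le_sInf ?_
      rintro _ ⟨γ', P', h', rfl⟩
      exact_mod_cast h'.1
    refine ⟨S.sdpValue.toReal, (EReal.coe_toReal ?_ ?_).symm⟩
    · exact ne_top_of_le_ne_top (EReal.coe_ne_top γ) hle
    · exact ne_bot_of_le_ne_bot (EReal.zero_ne_bot) hge

variable [Fintype m]

theorem dotProduct_lmiMatrix_mulVec (S : ClosedLoop n m p r) (γ : ℝ) (P : Matrix n n ℝ)
    (w : n ⊕ m → ℝ) :
    w ⬝ᵥ (S.lmiMatrix γ P *ᵥ w) =
      (Matrix.fromCols S.A S.B *ᵥ w) ⬝ᵥ (P *ᵥ (Matrix.fromCols S.A S.B *ᵥ w)) -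
        (w ∘ Sum.inl) ⬝ᵥ (P *ᵥ (w ∘ Sum.inl)) +
        (Matrix.fromCols S.Cp S.Dp *ᵥ w) ⬝ᵥ (Matrix.fromCols S.Cp S.Dp *ᵥ w) -
        γ * ((Matrix.fromCols S.Cr S.Dr *ᵥ w) ⬝ᵥ (Matrix.fromCols S.Cr S.Dr *ᵥ w)) := by
  have hblock : Matrix.fromBlocks (S.Aᵀ * P * S.A - P) (S.Aᵀ * P * S.B)
      (S.Bᵀ * P * S.A) (S.Bᵀ * P * S.B) =
      (Matrix.fromCols S.A S.B)ᵀ * (P * Matrix.fromCols S.A S.B) - Matrix.fromBlocks P 0 0 0 := by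
    rw [Matrix.transpose_fromCols, Matrix.mul_fromCols, Matrix.fromRows_mul_fromCols,
      sub_eq_add_neg (Matrix.fromBlocks _ _ _ _), Matrix.fromBlocks_neg, Matrix.fromBlocks_add]
    simp [Matrix.mul_assoc, sub_eq_add_neg]
  have hP : w ⬝ᵥ (Matrix.fromBlocks P 0 0 (0 : Matrix m m ℝ) *ᵥ w) =
      (w ∘ Sum.inl) ⬝ᵥ (P *ᵥ (w ∘ Sum.inl)) := by
    rw [Matrix.fromBlocks_mulVec]
    simp [dotProduct]
  rw [lmiMatrix, hblock, Matrix.sub_mulVec, Matrix.add_mulVec, Matrix.sub_mulVec,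
    Matrix.smul_mulVec, dotProduct_sub, dotProduct_add, dotProduct_sub, dotProduct_smul,
    dotProduct_transpose_mul_mulVec, dotProduct_transpose_mul_mulVec,
    dotProduct_transpose_mul_mulVec, hP, ← Matrix.mulVec_mulVec, smul_eq_mul]

/-- Feasibility is the dissipation inequality with storage `xᵀ P x` and supply
`γ |y_r|² - |y_p|²`. -/
theorem feasible_iff (S : ClosedLoop n m p r) (γ : ℝ) (P : Matrix n n ℝ) :
    S.Feasible γ P ↔ 0 ≤ γ ∧ P.IsSymm ∧ ∀ w : n ⊕ m → ℝ,
      (Matrix.fromCols S.A S.B *ᵥ w) ⬝ᵥ (P *ᵥ (Matrix.fromCols S.A S.B *ᵥ w)) -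
        (w ∘ Sum.inl) ⬝ᵥ (P *ᵥ (w ∘ Sum.inl)) +
        (Matrix.fromCols S.Cp S.Dp *ᵥ w) ⬝ᵥ (Matrix.fromCols S.Cp S.Dp *ᵥ w) ≤
        γ * ((Matrix.fromCols S.Cr S.Dr *ᵥ w) ⬝ᵥ (Matrix.fromCols S.Cr S.Dr *ᵥ w)) := by
  refine and_congr_right fun _ => and_congr_right fun hP => ?_
  have hquad : ∀ w : n ⊕ m → ℝ,
      star w ⬝ᵥ (-(S.lmiMatrix γ P) *ᵥ w) = -(w ⬝ᵥ (S.lmiMatrix γ P *ᵥ w)) := by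
    intro w
    rw [star_trivial, Matrix.neg_mulVec, dotProduct_neg]
  rw [Matrix.posSemidef_iff_dotProduct_mulVec]
  constructor
  · rintro ⟨-, h⟩ w
    have := h w
    rw [hquad, dotProduct_lmiMatrix_mulVec] at this
    linarith
  · refine fun h => ⟨?_, fun w => ?_⟩
    · rw [Matrix.IsHermitian, Matrix.conjTranspose_eq_transpose_of_trivial, Matrix.transpose_neg,
        (S.isSymm_lmiMatrix γ hP).eq]
    · rw [hquad, dotProduct_lmiMatrix_mulVec]
      linarith [h w]

/-- The frequency domain inequality: along complex exponentials of modulus one the performance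
output is bounded by the detector output. -/
theorem Feasible.sum_norm_sq_le {S : ClosedLoop n m p r} {γ : ℝ} {P : Matrix n n ℝ}
    (h : S.Feasible γ P) {z : ℂ} (hz : ‖z‖ = 1) {w : n ⊕ m → ℂ}
    (hw : (Matrix.fromCols S.A S.B).map Complex.ofReal *ᵥ w = z • (w ∘ Sum.inl)) :
    ∑ i, ‖((Matrix.fromCols S.Cp S.Dp).map Complex.ofReal *ᵥ w) i‖ ^ 2 ≤
      γ * ∑ i, ‖((Matrix.fromCols S.Cr S.Dr).map Complex.ofReal *ᵥ w) i‖ ^ 2 := by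
  obtain ⟨-, -, hdiss⟩ := (S.feasible_iff γ P).1 h
  have hre := hdiss fun j => (w j).re
  have him := hdiss fun j => (w j).im
  have hstate := P.quadForm_re_add_quadForm_im_smul z (w ∘ Sum.inl)
  rw [← hw, hz, one_pow, one_mul] at hstate
  simp only [re_map_ofReal_mulVec, im_map_ofReal_mulVec] at hstate
  rw [sum_norm_sq_map_ofReal_mulVec, sum_norm_sq_map_ofReal_mulVec]
  simp only [Function.comp_def] at hre him hstate
  linarith

end ClosedLoop

/-! ### Vanishing order along the unit circle -/

section Order

open Filter Asymptotics

variable {F : Type*} [NormedAddCommGroup F] [NormedSpace ℂ F] {z₀ : ℂ}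

/-- A vector `v` with `(z - z₀)ᵏ v = O((z - z₀)ᵏ⁺¹)` along some approach to `z₀` vanishes. -/
theorem eq_zero_of_pow_smul_isBigO_pow {l : Filter ℂ} [l.NeBot] (hl : l ≤ 𝓝[≠] z₀) {g : ℂ → F}
    {v : F} (hg : Tendsto g l (𝓝 v)) {j k : ℕ} (hjk : j < k)
    (h : (fun z => (z - z₀) ^ j • g z) =O[l] fun z => (z - z₀) ^ k) : v = 0 := by
  have hne : ∀ᶠ z in l, z ≠ z₀ := hl self_mem_nhdsWithin
  have hl' : l ≤ 𝓝 z₀ := hl.trans nhdsWithin_le_nhds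
  obtain ⟨C, hC⟩ := h.bound
  have hbound : ∀ᶠ z in l, ‖g z‖ ≤ C * ‖z - z₀‖ ^ (k - j) := by
    filter_upwards [hC, hne] with z hz hz0
    have hpos : 0 < ‖z - z₀‖ ^ j := pow_pos (norm_pos_iff.2 (sub_ne_zero.2 hz0)) _
    rw [norm_smul, norm_pow, norm_pow, ← Nat.sub_add_cancel hjk.le, pow_add, ← mul_assoc,
      mul_comm] at hz
    simpa using le_of_mul_le_mul_right hz hpos
  have hlim : Tendsto (fun z => C * ‖z - z₀‖ ^ (k - j)) l (𝓝 0) := by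
    have hc : Continuous fun z : ℂ => C * ‖z - z₀‖ ^ (k - j) := by fun_prop
    have := (hc.tendsto z₀).mono_left hl'
    simpa [Nat.sub_ne_zero_of_lt hjk] using this
  exact tendsto_nhds_unique hg (squeeze_zero_norm' hbound hlim)

/-- The vanishing order of an analytic function is detected along any approach to the point. -/
theorem AnalyticAt.isBigO_pow_of_isBigO {f : ℂ → F} (hf : AnalyticAt ℂ f z₀) {l : Filter ℂ}
    [l.NeBot] (hl : l ≤ 𝓝[≠] z₀) {k : ℕ} (h : f =O[l] fun z => (z - z₀) ^ k) :
    f =O[𝓝 z₀] fun z => (z - z₀) ^ k := by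
  have hl' : l ≤ 𝓝 z₀ := hl.trans nhdsWithin_le_nhds
  by_cases hk : (k : ℕ∞) ≤ analyticOrderAt f z₀
  · obtain ⟨g, hg, hfg⟩ := (natCast_le_analyticOrderAt hf).1 hk
    have h1 : (fun z => (z - z₀) ^ k • g z) =O[𝓝 z₀] fun z => (z - z₀) ^ k := by
      have := (isBigO_refl (fun z : ℂ => (z - z₀) ^ k) (𝓝 z₀)).smul
        (hg.continuousAt.isBigO_one ℂ)
      simpa using this
    exact h1.congr' (hfg.mono fun _ h => h.symm) EventuallyEq.rfl
  · exfalso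
    rw [not_le] at hk
    obtain ⟨j, hj⟩ := ENat.ne_top_iff_exists.1 hk.ne_top
    rw [← hj, Nat.cast_lt] at hk
    obtain ⟨g, hg, hg0, hfg⟩ := hf.analyticOrderAt_eq_natCast.1 hj.symm
    exact hg0 (eq_zero_of_pow_smul_isBigO_pow hl (hg.continuousAt.tendsto.mono_left hl') hk
      (h.congr' (hl' hfg) EventuallyEq.rfl))

/-- A connected set with two points has no isolated point. Needed because the frequency inequality
is available only on the circle. -/
theorem neBot_nhdsNE_inf_principal_unit_sphere (hz₀ : ‖z₀‖ = 1) :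
    (𝓝[≠] z₀ ⊓ 𝓟 (Metric.sphere (0 : ℂ) 1)).NeBot := by
  have hpre : IsPreconnected (Metric.sphere (0 : ℂ) 1) :=
    isPreconnected_sphere (by simp [Complex.rank_real_complex]) 0 1
  refine hpre.preperfect_of_nontrivial ⟨1, by simp, -1, by simp, ?_⟩ z₀ (by simpa using hz₀)
  norm_num [Complex.ext_iff]

end Order

/-! ### Transfer matrices near a regular point -/

namespace StateSpace

variable {n m p : Type*} [Fintype n] [DecidableEq n]

-- By Cramer's rule the resolvent entries are polynomials divided by the characteristic polynomial,
-- which does not vanish at `z₀`.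
open Polynomial in
theorem analyticAt_transfer_apply (S : StateSpace n m p) {z₀ : ℂ}
    (hz₀ : IsUnit (z₀ • (1 : Matrix n n ℂ) - S.A.map Complex.ofReal)) (i : p) (j : m) :
    AnalyticAt ℂ (fun z => S.transfer z i j) z₀ := by
  set A := S.A.map Complex.ofReal with hA
  have hmap : ∀ z : ℂ, z • (1 : Matrix n n ℂ) - A = (evalRingHom z).mapMatrix A.charmatrix := by
    intro z
    ext a b
    by_cases hab : a = b
    · subst hab
      simp [Matrix.charmatrix_apply_eq]
    · simp [Matrix.charmatrix_apply_ne _ _ _ hab, Matrix.one_apply_ne hab]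
  have hinv : ∀ z : ℂ, (z • (1 : Matrix n n ℂ) - A)⁻¹ = fun a b =>
      (A.charpoly.eval z)⁻¹ * (A.charmatrix.adjugate a b).eval z := by
    intro z
    rw [Matrix.inv_def, hmap, ← RingHom.map_adjugate, ← RingHom.map_det, Ring.inverse_eq_inv]
    rfl
  have hdet : A.charpoly.eval z₀ ≠ 0 := by
    rw [Matrix.isUnit_iff_isUnit_det, hmap, ← RingHom.map_det] at hz₀
    exact hz₀.ne_zero
  have hpoly : ∀ q : ℂ[X], AnalyticAt ℂ (fun z => q.eval z) z₀ := fun q =>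
    q.differentiable.analyticAt z₀
  have hentry : ∀ a b, AnalyticAt ℂ (fun z => (z • (1 : Matrix n n ℂ) - A)⁻¹ a b) z₀ := by
    intro a b
    simp only [hinv]
    exact ((hpoly _).inv hdet).mul (hpoly _)
  simp only [transfer, ← hA, Matrix.add_apply, Matrix.mul_apply]
  refine AnalyticAt.add (Finset.analyticAt_fun_sum _ fun b _ => AnalyticAt.mul
    (Finset.analyticAt_fun_sum _ fun a _ => ?_) analyticAt_const) analyticAt_const
  exact analyticAt_const.mul (hentry _ _)

theorem analyticAt_transfer_mulVec [Fintype m] [Fintype p] (S : StateSpace n m p) {z₀ : ℂ}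
    (hz₀ : IsUnit (z₀ • (1 : Matrix n n ℂ) - S.A.map Complex.ofReal)) (s : m → Polynomial ℂ) :
    AnalyticAt ℂ (fun z => S.transfer z *ᵥ fun j => (s j).eval z) z₀ := by
  rw [analyticAt_pi_iff]
  intro i
  simp only [Matrix.mulVec, dotProduct]
  exact Finset.analyticAt_fun_sum _ fun j _ =>
    (S.analyticAt_transfer_apply hz₀ i j).mul ((s j).differentiable.analyticAt z₀)

theorem IsZeroAlong.isZero [Fintype m] [Fintype p] {S : StateSpace n m p} {z₀ : ℂ} {k : ℕ}
    {s : m → Polynomial ℂ} (h : S.IsZeroAlong z₀ k s) : S.IsZero z₀ := by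
  obtain ⟨hk, hs, hO⟩ := h
  obtain ⟨c, hc⟩ := hO.bound
  refine ⟨_, hs, ?_⟩
  have := hc.self_of_nhds
  simpa [(Nat.one_le_iff_ne_zero.1 hk)] using this

end StateSpace

theorem eventually_isUnit_smul_one_sub {n : Type*} [Fintype n] [DecidableEq n]
    {A : Matrix n n ℂ} {z₀ : ℂ} (h : IsUnit (z₀ • (1 : Matrix n n ℂ) - A)) :
    ∀ᶠ z in 𝓝 z₀, IsUnit (z • (1 : Matrix n n ℂ) - A) := by
  simp only [Matrix.isUnit_iff_isUnit_det, isUnit_iff_ne_zero] at h ⊢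
  have hc : Continuous fun z : ℂ => (z • (1 : Matrix n n ℂ) - A).det :=
    Continuous.matrix_det (by fun_prop)
  exact hc.continuousAt.eventually_ne h

theorem norm_le_sqrt_sum_norm_sq {ι : Type*} [Fintype ι] (y : ι → ℂ) :
    ‖y‖ ≤ √(∑ i, ‖y i‖ ^ 2) :=
  (pi_norm_le_iff_of_nonneg (Real.sqrt_nonneg _)).2 fun i => Real.le_sqrt_of_sq_le
    (Finset.single_le_sum (f := fun i => ‖y i‖ ^ 2) (fun _ _ => by positivity) (Finset.mem_univ i))

theorem sum_norm_sq_le_card_mul_norm_sq {ι : Type*} [Fintype ι] (y : ι → ℂ) :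
    ∑ i, ‖y i‖ ^ 2 ≤ Fintype.card ι * ‖y‖ ^ 2 := by
  have := Finset.sum_le_card_nsmul Finset.univ (fun i => ‖y i‖ ^ 2) (‖y‖ ^ 2) fun i _ => by
    gcongr
    exact norm_le_pi_norm y i
  simpa using this

namespace StateSpace

variable {n m p : Type*} [Fintype n] [DecidableEq n]

/-- The same dynamics and output map, driven directly through the state equation. -/
def stateDriven (S : StateSpace n m p) : StateSpace n n p := ⟨S.A, 1, S.C, 0⟩

theorem stateDriven_transfer_mulVec (S : StateSpace n m p) (z : ℂ) (e : n → ℂ) :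
    S.stateDriven.transfer z *ᵥ e = S.C.map Complex.ofReal *ᵥ
      ((z • (1 : Matrix n n ℂ) - S.A.map Complex.ofReal)⁻¹ *ᵥ e) := by
  have h1 : (1 : Matrix n n ℝ).map Complex.ofReal = 1 :=
    Matrix.map_one _ Complex.ofReal_zero Complex.ofReal_one
  have h0 : (0 : Matrix p n ℝ).map Complex.ofReal = 0 := Matrix.map_zero _ Complex.ofReal_zero
  simp [transfer, stateDriven, h1, h0, Matrix.mulVec_mulVec]

/-- The defect `e` of the state equation is zero for the frequency inequality and of order `(z - z₀)
^ (k + 1)` for trajectories built from chains. -/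
theorem output_eq_transfer_mulVec_add [Fintype m] (S : StateSpace n m p) {z : ℂ}
    (hz : IsUnit (z • (1 : Matrix n n ℂ) - S.A.map Complex.ofReal)) {x e : n → ℂ} {s : m → ℂ}
    (h : (z • (1 : Matrix n n ℂ) - S.A.map Complex.ofReal) *ᵥ x =
      S.B.map Complex.ofReal *ᵥ s + e) :
    S.C.map Complex.ofReal *ᵥ x + S.D.map Complex.ofReal *ᵥ s =
      S.transfer z *ᵥ s + S.stateDriven.transfer z *ᵥ e := by
  have hx : x = (z • (1 : Matrix n n ℂ) - S.A.map Complex.ofReal)⁻¹ *ᵥ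
      (S.B.map Complex.ofReal *ᵥ s + e) := by
    rw [← h, Matrix.mulVec_mulVec, Matrix.nonsing_inv_mul _
      ((Matrix.isUnit_iff_isUnit_det _).1 hz), Matrix.one_mulVec]
  rw [stateDriven_transfer_mulVec, transfer, Matrix.add_mulVec, hx]
  simp only [Matrix.mulVec_add, Matrix.mulVec_mulVec, Matrix.mul_assoc]
  abel

end StateSpace

/-! ### Necessity: the frequency domain inequality -/

namespace ClosedLoop

open Filter Asymptotics

variable {n m p r : Type*} [Fintype n] [DecidableEq n]

theorem IsStable.isUnit_smul_one_sub {S : ClosedLoop n m p r} (hS : S.IsStable) {z : ℂ}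
    (hz : ‖z‖ = 1) : IsUnit (z • (1 : Matrix n n ℂ) - S.A.map Complex.ofReal) := by
  by_contra h
  have hmem : z ∈ spectrum ℂ (S.A.map Complex.ofReal) := by
    rw [spectrum.mem_iff, Algebra.algebraMap_eq_smul_one]
    exact h
  exact absurd (hS z hmem) (by rw [hz]; exact lt_irrefl _)

variable [Fintype m] [Fintype p] [Fintype r]

/-- The frequency domain inequality on the unit circle, in terms of the transfer matrices. -/
theorem Feasible.sum_norm_sq_transfer_le {S : ClosedLoop n m p r} (hS : S.IsStable) {γ : ℝ}
    {P : Matrix n n ℝ} (h : S.Feasible γ P) {z : ℂ} (hz : ‖z‖ = 1) (s : m → ℂ) :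
    ∑ i, ‖(S.perf.transfer z *ᵥ s) i‖ ^ 2 ≤
      γ * ∑ i, ‖(S.detector.transfer z *ᵥ s) i‖ ^ 2 := by
  have hu := hS.isUnit_smul_one_sub hz
  set x := (z • (1 : Matrix n n ℂ) - S.A.map Complex.ofReal)⁻¹ *ᵥ (S.B.map Complex.ofReal *ᵥ s)
    with hx
  have hstate : (z • (1 : Matrix n n ℂ) - S.A.map Complex.ofReal) *ᵥ x =
      S.B.map Complex.ofReal *ᵥ s + 0 := by
    rw [hx, Matrix.mulVec_mulVec, Matrix.mul_nonsing_inv _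
      ((Matrix.isUnit_iff_isUnit_det _).1 hu), Matrix.one_mulVec, add_zero]
  have hfdi := h.sum_norm_sq_le hz (w := Sum.elim x s) (by
    rw [Matrix.fromCols_map, Matrix.fromCols_mulVec_sumElim, Sum.elim_comp_inl]
    rw [Matrix.sub_mulVec, Matrix.smul_mulVec, Matrix.one_mulVec, add_zero,
      sub_eq_iff_eq_add] at hstate
    rw [hstate, add_comm])
  rw [Matrix.fromCols_map, Matrix.fromCols_map, Matrix.fromCols_mulVec_sumElim,
    Matrix.fromCols_mulVec_sumElim] at hfdi
  have hp := S.perf.output_eq_transfer_mulVec_add hu hstate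
  have hr := S.detector.output_eq_transfer_mulVec_add hu hstate
  rw [Matrix.mulVec_zero, add_zero] at hp hr
  rw [← hp, ← hr]
  exact hfdi

theorem Feasible.isZeroAlong {S : ClosedLoop n m p r} (hS : S.IsStable) {γ : ℝ}
    {P : Matrix n n ℝ} (h : S.Feasible γ P) {z₀ : ℂ} (hz₀ : ‖z₀‖ = 1) {k : ℕ}
    {s : m → Polynomial ℂ} (hr : S.detector.IsZeroAlong z₀ k s) : S.perf.IsZeroAlong z₀ k s := by
  obtain ⟨hk, hs, hO⟩ := hr
  refine ⟨hk, hs, ?_⟩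
  have := neBot_nhdsNE_inf_principal_unit_sphere hz₀
  have hl : 𝓝[≠] z₀ ⊓ 𝓟 (Metric.sphere (0 : ℂ) 1) ≤ 𝓝[≠] z₀ := inf_le_left
  refine (S.perf.analyticAt_transfer_mulVec (hS.isUnit_smul_one_sub hz₀) s).isBigO_pow_of_isBigO
    hl (IsBigO.trans ?_ (hO.mono (hl.trans nhdsWithin_le_nhds)))
  -- The factor `card r` converts the Euclidean norm of the detector output into the sup norm used
  -- by `=O`.
  refine IsBigO.of_bound √(γ * Fintype.card r) ?_
  filter_upwards [mem_inf_of_right (mem_principal_self _)] with z hz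
  have hfdi := h.sum_norm_sq_transfer_le hS (z := z) (by simpa using hz)
    fun j => (s j).eval z
  refine (norm_le_sqrt_sum_norm_sq _).trans ?_
  rw [← Real.sqrt_sq (norm_nonneg (S.detector.transfer z *ᵥ fun j => (s j).eval z)),
    ← Real.sqrt_mul (mul_nonneg h.1 (Nat.cast_nonneg _)), mul_assoc]
  exact Real.sqrt_le_sqrt (hfdi.trans
    (mul_le_mul_of_nonneg_left (sum_norm_sq_le_card_mul_norm_sq _) h.1))

end ClosedLoop

/-! ### Root polynomials from Jordan chains -/

section PolynomialChains

open Polynomial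

variable {ι V Y Y' : Type*} [Fintype ι]
  [NormedAddCommGroup V] [InnerProductSpace ℂ V]
  [NormedAddCommGroup Y] [InnerProductSpace ℂ Y]
  [NormedAddCommGroup Y'] [InnerProductSpace ℂ Y']

/-- The value at `z` of a vector of polynomials. -/
noncomputable def evalVec (ω : ι → ℂ[X]) (z : ℂ) : EuclideanSpace ℂ ι :=
  WithLp.toLp 2 fun i => (ω i).eval z

/-- A Jordan chain at `z₀` ending in `w` is either shorter than its length suggests or comes from a
root polynomial of the pencil. -/
theorem exists_polynomial_of_mem_chainSpace {E Φ : EuclideanSpace ℂ ι →L[ℂ] V}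
    {Yr : EuclideanSpace ℂ ι →L[ℂ] Y} {Yp : EuclideanSpace ℂ ι →L[ℂ] Y'} {z₀ : ℂ} {k : ℕ}
    {w : EuclideanSpace ℂ ι} (hYp : ∀ u ∈ chainSpace E Φ Yr z₀ k, Yp u = 0)
    (hw : w ∈ chainSpace E Φ Yr z₀ (k + 1)) :
    w ∈ chainSpace E Φ Yr z₀ k ∨ ∃ ω : ι → ℂ[X], evalVec ω z₀ ≠ 0 ∧ ∀ z,
      z • E (evalVec ω z) - Φ (evalVec ω z) = (z - z₀) ^ (k + 1) • E w ∧
      Yr (evalVec ω z) = 0 ∧ Yp (evalVec ω z) = (z - z₀) ^ k • Yp w := by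
  induction k generalizing w with
  | zero =>
    obtain ⟨hY, u, hu, hE⟩ := mem_chainSpace_succ.1 hw
    rw [mem_chainSpace_zero] at hu ⊢
    rw [hu, map_zero, eq_comm, sub_eq_zero] at hE
    refine or_iff_not_imp_left.2 fun hw0 => ?_
    have hev : ∀ z, evalVec (fun i => C (w i)) z = w := by
      intro z
      ext i
      simp [evalVec]
    refine ⟨fun i => C (w i), by rwa [hev], fun z => ?_⟩
    simp [hev, hY, ← hE, sub_smul]
  | succ k ih =>
    obtain ⟨hY, u, hu, hE⟩ := mem_chainSpace_succ.1 hw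
    have hu' : -u ∈ chainSpace E Φ Yr z₀ (k + 1) := Submodule.neg_mem _ hu
    -- The sign of `-u` makes its error term `-(z - z₀) ^ (k + 1) • E u` cancel the one created by
    -- appending `(z - z₀) ^ (k + 1) • w`. If `-u` ends a shorter chain, so does `w`.
    rcases ih (fun v hv => hYp v (chainSpace_le_succ k hv)) hu' with h | ⟨ω, hω0, hω⟩
    · exact Or.inl (mem_chainSpace_succ.2 ⟨hY, u, by simpa using h, hE⟩)
    · right
      have hev : ∀ z, evalVec (fun i => ω i + (X - C z₀) ^ (k + 1) * C (w i)) z =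
          evalVec ω z + (z - z₀) ^ (k + 1) • w := by
        intro z
        ext i
        simp [evalVec]
      refine ⟨fun i => ω i + (X - C z₀) ^ (k + 1) * C (w i), by simpa [hev] using hω0,
        fun z => ?_⟩
      obtain ⟨h1, h2, h3⟩ := hω z
      have hΦ : Φ w = z₀ • E w - E u := by rw [hE]; abel
      refine ⟨?_, by simp [hev, h2, hY], by simp [hev, h3, hYp u hu]⟩
      calc z • E (evalVec (fun i => ω i + (X - C z₀) ^ (k + 1) * C (w i)) z) -
            Φ (evalVec (fun i => ω i + (X - C z₀) ^ (k + 1) * C (w i)) z)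
          = (z • E (evalVec ω z) - Φ (evalVec ω z)) +
              (z - z₀) ^ (k + 1) • (z • E w - Φ w) := by
            rw [hev, map_add, map_add, map_smul, map_smul]
            module
        _ = (z - z₀) ^ (k + 1 + 1) • E w := by
            rw [h1, hΦ, map_neg, pow_succ _ (k + 1)]
            module

end PolynomialChains

/-! ### Passage between matrices and operators -/

section EuclideanMulVec

variable {a b : Type*} [Fintype a] [Fintype b]

/-- Multiplication by a matrix as a continuous linear map of Euclidean spaces. -/
noncomputable def Matrix.euclideanMulVec (M : Matrix a b ℂ) :
    EuclideanSpace ℂ b →L[ℂ] EuclideanSpace ℂ a :=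
  LinearMap.toContinuousLinearMap ((WithLp.linearEquiv 2 ℂ (a → ℂ)).symm.toLinearMap ∘ₗ
    M.mulVecLin ∘ₗ (WithLp.linearEquiv 2 ℂ (b → ℂ)).toLinearMap)

theorem Matrix.ofLp_euclideanMulVec (M : Matrix a b ℂ) (w : EuclideanSpace ℂ b) :
    WithLp.ofLp (M.euclideanMulVec w) = M *ᵥ WithLp.ofLp w := rfl

/-- The real part of a complex quadratic form, restricted to real vectors, is given by a real
symmetric matrix. -/
theorem exists_isSymm_re_inner_eq (P : EuclideanSpace ℂ b →L[ℂ] EuclideanSpace ℂ b) :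
    ∃ Q : Matrix b b ℝ, Q.IsSymm ∧ ∀ (x : b → ℝ),
      (inner ℂ (P (WithLp.toLp 2 fun j => (x j : ℂ))) (WithLp.toLp 2 fun j => (x j : ℂ))).re =
        x ⬝ᵥ (Q *ᵥ x) := by
  classical
  let R : Matrix b b ℝ := fun i j => (P (EuclideanSpace.single j 1) i).re
  refine ⟨(1 / 2 : ℝ) • (R + Rᵀ), ?_, fun x => ?_⟩
  · rw [Matrix.IsSymm, Matrix.transpose_smul, Matrix.transpose_add, Matrix.transpose_transpose,
      add_comm]
  · have hx : (WithLp.toLp 2 fun j => (x j : ℂ) : EuclideanSpace ℂ b) =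
        ∑ j, (x j : ℂ) • EuclideanSpace.single j 1 := by
      ext i
      simp [Finset.sum_apply, Pi.single_apply]
    have hP : ∀ i, (P (WithLp.toLp 2 fun j => (x j : ℂ)) i).re = (R *ᵥ x) i := by
      intro i
      rw [hx, map_sum]
      simp [R, Matrix.mulVec, dotProduct, mul_comm]
    have hR : x ⬝ᵥ (Rᵀ *ᵥ x) = x ⬝ᵥ (R *ᵥ x) := by
      rw [Matrix.mulVec_transpose, dotProduct_comm, ← Matrix.dotProduct_mulVec]
    rw [EuclideanSpace.inner_eq_star_dotProduct, Matrix.smul_mulVec, Matrix.add_mulVec,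
      dotProduct_smul, dotProduct_add, hR]
    have : ((fun j => (x j : ℂ)) ⬝ᵥ star (WithLp.ofLp (P (WithLp.toLp 2 fun j => (x j : ℂ))))).re =
        x ⬝ᵥ (R *ᵥ x) := by
      simp [dotProduct, ← hP]
    rw [this, smul_eq_mul]
    ring

end EuclideanMulVec

/-! ### Sufficiency: from zeros to chains to feasibility -/

section Main

open Filter Asymptotics

theorem ofLp_fromCols_map_euclideanMulVec {a b c : Type*} [Fintype a] [Fintype b] [Fintype c]
    (M : Matrix c a ℝ) (N : Matrix c b ℝ) (w : EuclideanSpace ℂ (a ⊕ b)) :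
    WithLp.ofLp (((Matrix.fromCols M N).map Complex.ofReal).euclideanMulVec w) =
      M.map Complex.ofReal *ᵥ (WithLp.ofLp w ∘ Sum.inl) +
        N.map Complex.ofReal *ᵥ (WithLp.ofLp w ∘ Sum.inr) := by
  rw [Matrix.ofLp_euclideanMulVec, Matrix.fromCols_map, Matrix.fromCols_mulVec]

theorem norm_sq_map_ofReal_euclideanMulVec {b c : Type*} [Fintype b] [Fintype c]
    (M : Matrix c b ℝ) (w : b → ℝ) :
    ‖(M.map Complex.ofReal).euclideanMulVec (WithLp.toLp 2 fun j => (w j : ℂ))‖ ^ 2 =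
      (M *ᵥ w) ⬝ᵥ (M *ᵥ w) := by
  rw [EuclideanSpace.norm_sq_eq, Matrix.ofLp_euclideanMulVec, map_ofReal_mulVec_ofReal]
  simp [dotProduct, sq]

theorem StateSpace.isBigO_stateDriven_transfer_mulVec {n m p : Type*} [Fintype n] [DecidableEq n]
    [Fintype p] (S : StateSpace n m p) {z₀ : ℂ}
    (hz₀ : IsUnit (z₀ • (1 : Matrix n n ℂ) - S.A.map Complex.ofReal)) (k : ℕ) (e : n → ℂ) :
    (fun z => S.stateDriven.transfer z *ᵥ ((z - z₀) ^ k • e)) =O[𝓝 z₀]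
      fun z => (z - z₀) ^ k := by
  have han := (S.stateDriven.analyticAt_transfer_mulVec hz₀
    fun i => Polynomial.C (e i)).continuousAt.isBigO_one ℂ
  have := (isBigO_refl (fun z : ℂ => (z - z₀) ^ k) (𝓝 z₀)).smul han
  simpa [Matrix.mulVec_smul] using this

namespace ClosedLoop

section StatePencil

variable (n m : Type*) [Fintype n] [DecidableEq n] [Fintype m]

/-- The map `(x, a) ↦ x`. -/
noncomputable def statePencil :
    EuclideanSpace ℂ (n ⊕ m) →L[ℂ] EuclideanSpace ℂ n :=
  (Matrix.fromCols (1 : Matrix n n ℂ) (0 : Matrix n m ℂ)).euclideanMulVec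

theorem ofLp_statePencil (w : EuclideanSpace ℂ (n ⊕ m)) :
    WithLp.ofLp (statePencil n m w) = WithLp.ofLp w ∘ Sum.inl := by
  rw [statePencil, Matrix.ofLp_euclideanMulVec, Matrix.fromCols_mulVec]
  simp

end StatePencil

variable {n m p r : Type*} [Fintype n] [Fintype m] [Fintype p] [Fintype r]

/-- The map `(x, a) ↦ A x + B a`. -/
noncomputable def successorPencil (S : ClosedLoop n m p r) :
    EuclideanSpace ℂ (n ⊕ m) →L[ℂ] EuclideanSpace ℂ n :=
  ((Matrix.fromCols S.A S.B).map Complex.ofReal).euclideanMulVec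

/-- The map `(x, a) ↦ y_p`. -/
noncomputable def perfOutput (S : ClosedLoop n m p r) :
    EuclideanSpace ℂ (n ⊕ m) →L[ℂ] EuclideanSpace ℂ p :=
  ((Matrix.fromCols S.Cp S.Dp).map Complex.ofReal).euclideanMulVec

/-- The map `(x, a) ↦ y_r`. -/
noncomputable def detectorOutput (S : ClosedLoop n m p r) :
    EuclideanSpace ℂ (n ⊕ m) →L[ℂ] EuclideanSpace ℂ r :=
  ((Matrix.fromCols S.Cr S.Dr).map Complex.ofReal).euclideanMulVec

variable [DecidableEq n]

theorem exists_feasible_of_chainSpace (S : ClosedLoop n m p r)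
    (h : ∀ (z : ℂ) (k : ℕ), ‖z‖ = 1 →
      ∀ w ∈ chainSpace (statePencil n m) S.successorPencil S.detectorOutput z k, S.perfOutput w = 0) :
    ∃ γ P, S.Feasible γ P := by
  obtain ⟨P, γ, hP⟩ := exists_storage_of_chainSpace_le_ker (statePencil n m) S.successorPencil
    S.detectorOutput S.perfOutput h
  obtain ⟨Q, hQ, hPQ⟩ := exists_isSymm_re_inner_eq P
  -- The abstract storage theorem does not control the sign of `γ`; enlarging it keeps the
  -- inequality.
  refine ⟨max γ 0, Q, (S.feasible_iff _ _).2 ⟨le_max_right _ _, hQ, fun w => ?_⟩⟩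
  have hw := hP (WithLp.toLp 2 fun j => (w j : ℂ))
  have hE : (statePencil n m) (WithLp.toLp 2 fun j => (w j : ℂ)) =
      WithLp.toLp 2 fun i => (((w ∘ Sum.inl) i : ℝ) : ℂ) := by
    apply WithLp.ofLp_injective
    rw [ofLp_statePencil]
    rfl
  have hΦ : S.successorPencil (WithLp.toLp 2 fun j => (w j : ℂ)) =
      WithLp.toLp 2 fun i => ((Matrix.fromCols S.A S.B *ᵥ w) i : ℂ) := by
    apply WithLp.ofLp_injective
    rw [successorPencil, Matrix.ofLp_euclideanMulVec, map_ofReal_mulVec_ofReal]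
  rw [hE, hΦ, hPQ, hPQ, perfOutput, detectorOutput,
    norm_sq_map_ofReal_euclideanMulVec, norm_sq_map_ofReal_euclideanMulVec] at hw
  have hγ := mul_le_mul_of_nonneg_right (le_max_left γ 0)
    (dotProduct_self_star_nonneg (Matrix.fromCols S.Cr S.Dr *ᵥ w))
  rw [star_trivial] at hγ
  linarith

/-- Once the performance output vanishes on shorter chains, a chain ending in `w` gives a polynomial
input `s` with `G_r s = O((z - z₀) ^ (k + 1))` and `G_p s` equal to `(z - z₀) ^ k` times the
performance output of `w`, up to the same order. The zero condition then kills that leading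
coefficient. -/
theorem perfOutput_eq_zero_of_mem_chainSpace {S : ClosedLoop n m p r} (hS : S.IsStable) {z₀ : ℂ}
    (hz₀ : ‖z₀‖ = 1)
    (h : ∀ (k : ℕ) (s : m → Polynomial ℂ),
      S.detector.IsZeroAlong z₀ k s → S.perf.IsZeroAlong z₀ k s) (k : ℕ) :
    ∀ w ∈ chainSpace (statePencil n m) S.successorPencil S.detectorOutput z₀ k,
      S.perfOutput w = 0 := by
  induction k with
  | zero =>
    intro w hw
    rw [mem_chainSpace_zero] at hw
    simp [hw]
  | succ k ih =>
    intro w hw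
    rcases exists_polynomial_of_mem_chainSpace ih hw with hw | ⟨ω, hω0, hω⟩
    · exact ih w hw
    have hu := hS.isUnit_smul_one_sub hz₀
    set s : m → Polynomial ℂ := fun j => ω (Sum.inr j)
    set x : ℂ → n → ℂ := fun z i => (ω (Sum.inl i)).eval z
    set e : n → ℂ := WithLp.ofLp w ∘ Sum.inl
    have hstate : ∀ z, (z • (1 : Matrix n n ℂ) - S.A.map Complex.ofReal) *ᵥ x z =
        S.B.map Complex.ofReal *ᵥ (fun j => (s j).eval z) + (z - z₀) ^ (k + 1) • e := by
      intro z
      have := congrArg WithLp.ofLp (hω z).1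
      rw [WithLp.ofLp_sub, WithLp.ofLp_smul, WithLp.ofLp_smul, ofLp_statePencil,
        ofLp_statePencil, successorPencil, ofLp_fromCols_map_euclideanMulVec,
        sub_eq_iff_eq_add] at this
      rw [Matrix.sub_mulVec, Matrix.smul_mulVec, Matrix.one_mulVec, sub_eq_iff_eq_add]
      refine Eq.trans this ?_
      change _ + (S.A.map Complex.ofReal *ᵥ x z +
        S.B.map Complex.ofReal *ᵥ (fun j => (s j).eval z)) = _
      abel
    -- If the input part vanished at `z₀`, stability would make the state part vanish as well,
    -- against `ω(z₀) ≠ 0`.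
    have hs : (fun j => (s j).eval z₀) ≠ 0 := by
      intro hs
      have hx := hstate z₀
      rw [hs, Matrix.mulVec_zero, sub_self, zero_pow k.succ_ne_zero, zero_smul, zero_add] at hx
      have hx0 : x z₀ = 0 := (Matrix.mulVec_injective_of_isUnit hu) (by rw [hx, Matrix.mulVec_zero])
      apply hω0
      apply WithLp.ofLp_injective
      ext (i | j)
      · exact congrFun hx0 i
      · exact congrFun hs j
    have hev := eventually_isUnit_smul_one_sub hu
    have hdet : S.detector.IsZeroAlong z₀ (k + 1) s := by
      refine ⟨Nat.le_add_left _ _, hs, ((S.detector.isBigO_stateDriven_transfer_mulVec hu (k + 1) e).neg_left).congr' ?_ EventuallyEq.rfl⟩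
      filter_upwards [hev] with z hz
      have hout := S.detector.output_eq_transfer_mulVec_add hz (hstate z)
      have hY := congrArg WithLp.ofLp (hω z).2.1
      rw [detectorOutput, ofLp_fromCols_map_euclideanMulVec] at hY
      rw [neg_eq_iff_add_eq_zero, add_comm, ← hout]
      exact hY
    obtain ⟨-, -, hO⟩ := h _ _ hdet
    have hsum : (fun z => (z - z₀) ^ k • WithLp.ofLp (S.perfOutput w)) =O[𝓝 z₀]
        fun z => (z - z₀) ^ (k + 1) := by
      refine (hO.add (S.perf.isBigO_stateDriven_transfer_mulVec hu (k + 1) e)).congr' ?_ EventuallyEq.rfl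
      filter_upwards [hev] with z hz
      have hout := S.perf.output_eq_transfer_mulVec_add hz (hstate z)
      have hY := congrArg WithLp.ofLp (hω z).2.2
      rw [WithLp.ofLp_smul] at hY
      rw [← hout, ← hY, perfOutput, ofLp_fromCols_map_euclideanMulVec]
      rfl
    exact WithLp.ofLp_injective _ (eq_zero_of_pow_smul_isBigO_pow (le_refl (𝓝[≠] z₀))
      tendsto_const_nhds (Nat.lt_succ_self k) (hsum.mono nhdsWithin_le_nhds))

end ClosedLoop

end Main

theorem lemma2 {n m p r : Type*} [Fintype n] [DecidableEq n] [Fintype m] [Fintype p] [Fintype r]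
    (S : ClosedLoop n m p r) (hS : S.IsStable) :
    (∃ v : ℝ, S.sdpValue = (v : EReal)) ↔
      (∀ z₀ : ℂ, ‖z₀‖ = 1 → ¬ S.detector.IsZero z₀) ∨
      (∀ z₀ : ℂ, ‖z₀‖ = 1 → ∀ (k : ℕ) (s : m → Polynomial ℂ),
        S.detector.IsZeroAlong z₀ k s → S.perf.IsZeroAlong z₀ k s) := by
  rw [S.exists_sdpValue_eq_coe_iff]
  constructor
  · rintro ⟨γ, P, h⟩
    exact Or.inr fun z₀ hz₀ k s => h.isZeroAlong hS hz₀
  · intro h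
    have h2 : ∀ z₀ : ℂ, ‖z₀‖ = 1 → ∀ (k : ℕ) (s : m → Polynomial ℂ),
        S.detector.IsZeroAlong z₀ k s → S.perf.IsZeroAlong z₀ k s :=
      h.elim (fun h1 z₀ hz₀ k s hr => absurd hr.isZero (h1 z₀ hz₀)) id
    exact S.exists_feasible_of_chainSpace fun z k hz =>
      ClosedLoop.perfOutput_eq_zero_of_mem_chainSpace hS hz (h2 z hz) k
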